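/- Let $n\ge 1$ and $m\ge 0$ be integers and let $K$ be a field (for example $K=\mathbb{C}$). Let $P(x)=x^{n-1}+\cdots+x+1$ and $Q(y)=a_my^m+\cdots+a_1y+a_0$ with $a_r\in K$, $a_m\neq 0$ ($a_m$ not necessarily $1$). Suppose that $P$ and $Q$ have all their zeros in $K$, let $x_1,\dots,x_{n-1}$ and $y_1,\dots,y_m$ be these zeros, listed with multiplicity, and suppose that $x_i\ne y_j$ for all $i,j$. Let $$\mathrm{PER}(P,Q)=\mathrm{per}\Bigl(\frac1{x_i-y_j}\Bigr)_{1\le i\le n-1,\,1\le j\le m}=\sum_{f}\prod_{i=1}^{n-1}\frac1{x_i-y_{f(i)}},$$ where $f$ runs over all injections $\{1,\dots,n-1\}\to\{1,\dots,m\}$ (so that $\mathrm{PER}(P,Q)=0$ if $m<n-1$). For an integer $r$, let $r\%n$ be the number between $1$ and $n$ that is congruent to $r$ modulo $n$. For $1\le s\le n$, let $\widetilde{\mathrm{diag}}{}^{\,s}_{n-1}(c_1,\dots,c_{n-1})$ be the $(n-1)\times(n-1)$ matrix with "jumping" broken diagonal whose entry in row $i$ and column $k$ is $c_k$ if $i=s+k-1$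 or $i=s+k-1-n$, and $0$ otherwise. Put $$\widetilde{\mathrm{Fes}}(Q)=\det\Bigl(\sum_{r=0}^m\widetilde{\mathrm{diag}}{}^{\,r\%n}_{n-1}\bigl(ra_r,(r-1)a_r,\dots,(r-n+2)a_r\bigr)-\sum_{r=0}^m\widetilde{\mathrm{diag}}{}^{\,(r-1)\%n}_{n-1}\bigl(ra_r,(r-1)a_r,\dots,(r-n+2)a_r\bigr)\Bigr).$$ Then the classical resultant $\mathrm{Res}(P,Q)=a_m^{n-1}\prod_{i,j}(x_i-y_j)$ is nonzero and $$\mathrm{PER}(P,Q)=\frac{\widetilde{\mathrm{Fes}}(Q)}{\mathrm{Res}(P,Q)}.$$ -/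

import Mathlib

/-- The permanent of a rectangular matrix: the sum, over all ways of choosing one entry from each
row so that no two chosen entries share a column, of the product of the chosen entries. It is `0`
if there are more rows than columns. -/
noncomputable def rectPermanent {ι κ K : Type*} [Fintype ι] [Fintype κ]
    [CommRing K] (A : Matrix ι κ K) : K :=
  ∑ f : ι ↪ κ, ∏ i, A i (f i)

/-- The Scott-type permanent of two finite lists of zeros: the permanent of the rectangular
matrix `(1 / (x i - y j))`. -/
noncomputable def scottPermanent {K : Type*} [Field K] {k m : ℕ} (x : Fin k → K) (y : Fin m → K) : K :=
  rectPermanent (Matrix.of fun i j => 1 / (x i - y j))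

/-- For `1 ≤ n`, the number between `1` and `n` that is congruent to `r` modulo `n`. -/
def residueFromOne (r : ℤ) (n : ℕ) : ℕ :=
  ((r - 1) % (n : ℤ)).toNat + 1

/-- The `(n - 1) × (n - 1)` "jumping" broken-diagonal matrix, for `1 ≤ s ≤ n`. In one-based
numbering, the entry `c k` of column `k` sits in row `s + k - 1` as long as this is at most
`n - 1`, in no row if `s + k - 1 = n`, and in row `s + k - 1 - n` if `s + k - 1 > n`; all other
entries vanish. (Below, `i` and `j` are zero-based.) -/
def jumpDiag {K : Type*} [CommRing K] (n s : ℕ) (c : Fin (n - 1) → K) :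
    Matrix (Fin (n - 1)) (Fin (n - 1)) K :=
  Matrix.of fun i j =>
    if (i : ℕ) + 1 = s + (j : ℕ) ∨ (i : ℕ) + 1 + n = s + (j : ℕ) then c j else 0

/-- The determinant Fes-tilde attached to `Q = a m * y ^ m + ⋯ + a 1 * y + a 0`. The vector
`fun j => (r - j) * a r`, `j = 0, …, n - 2`, is `(r a_r, (r - 1) a_r, …, (r - n + 2) a_r)`. -/
def fesTilde {K : Type*} [CommRing K] (n m : ℕ) (a : ℕ → K) : K :=
  Matrix.det
    ((∑ r ∈ Finset.range (m + 1),
        jumpDiag n (residueFromOne (r : ℤ) n) (fun j => ((r : K) - ((j : ℕ) : K)) * a r))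
      - ∑ r ∈ Finset.range (m + 1),
        jumpDiag n (residueFromOne ((r : ℤ) - 1) n) (fun j => ((r : K) - ((j : ℕ) : K)) * a r))

/-! Put N = n - 1 and let T be the map f ↦ W(f, Q) mod P on polynomials of degree < N, where W is
the Wronskian. Both sides of the identity, multiplied by Res(P, Q), equal det T.

Permanent side: composing T with evaluation at the zeros x_i multiplies its determinant by the
Vandermonde determinant and gives the matrix W(X^k, Q)(x_i). For monic Q with zeros y_j,
`det_wronskianEvalMatrix_of_injective` shows that the determinant of this matrix is Vandermonde
times ∏ (x_i - y_j) times the permanent. The Vandermonde factor is cancelled for indeterminate x_i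
and the result specialized (`det_wronskianModMatrix`), which covers repeated x_i, as occur when the
characteristic divides n.

Fes side: W(X^k, a_r X^r) = (r - k) a_r X^(r+k-1), and the difference of jumping diagonals applies
to it functionals that depend on exponents modulo n only and vanish on the ideal (P). On 1, X, …,
X^(N-1) these functionals form a unitriangular matrix, so the determinant is again det T
(`fesTilde_eq_det_wronskianModMatrix`). -/

open Polynomial in
/-- The values at `x i` of the Wronskians of `X ^ k` and `Q`. -/
noncomputable def wronskianEvalMatrix {R : Type*} [CommRing R] {N : ℕ} (x : Fin N → R) (Q : R[X]) :
    Matrix (Fin N) (Fin N) R :=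
  Matrix.of fun i k => (wronskian (X ^ (k : ℕ)) Q).eval (x i)

/-- The Scott-type permanent of `x` and `y`, multiplied by all the differences `x i - y j`. -/
noncomputable def clearedPermanent {R : Type*} [CommRing R] {N m : ℕ} (x : Fin N → R)
    (y : Fin m → R) : R :=
  rectPermanent (Matrix.of fun i j => ∏ l ∈ Finset.univ.erase j, (x i - y l))

/-! ### Expansion of rectangular permanents -/

theorem rectPermanent_mul_row {ι κ R : Type*} [Fintype ι] [Fintype κ] [CommRing R]
    (u : ι → R) (A : Matrix ι κ R) :
    rectPermanent (Matrix.of fun i j => u i * A i j) = (∏ i, u i) * rectPermanent A := by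
  simp [rectPermanent, Finset.prod_mul_distrib, Finset.mul_sum]

theorem rectPermanent_eq_sum_injective {ι κ R : Type*} [Fintype ι] [Fintype κ] [CommRing R]
    [DecidableEq ι] [DecidableEq κ] (A : Matrix ι κ R) :
    rectPermanent A = ∑ f : ι → κ with Function.Injective f, ∏ i, A i (f i) := by
  unfold rectPermanent
  refine Finset.sum_bij (fun f _ => ⇑f) ?_ ?_ ?_ ?_
  · intro f _
    simpa using f.injective
  · intro f _ g _ h
    exact DFunLike.coe_injective h
  · intro f hf
    exact ⟨⟨f, by simpa using hf⟩, by simp, rfl⟩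
  · intros; rfl

/-- An injection either avoids column 0 or meets it in exactly one row i; in the second case, row i
and column 0 are deleted. -/
theorem rectPermanent_succ {R : Type*} [CommRing R] {N m : ℕ}
    (A : Matrix (Fin (N + 1)) (Fin (m + 1)) R) :
    rectPermanent A = rectPermanent (A.submatrix id Fin.succ) +
      ∑ i, A i 0 * rectPermanent (A.submatrix i.succAbove Fin.succ) := by
  simp only [rectPermanent_eq_sum_injective, Matrix.submatrix_apply, id]
  classical
  rw [← Finset.sum_filter_add_sum_filter_not _ (fun f : Fin (N + 1) → Fin (m + 1) => ∀ i, f i ≠ 0)]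
  congr 1
  · symm
    refine Finset.sum_bij (fun f _ i => (f i).succ) ?_ ?_ ?_ ?_
    · intro f hf
      simp only [Finset.mem_filter, Finset.mem_univ, true_and] at hf ⊢
      exact ⟨(Fin.succ_injective m).comp hf, fun i => Fin.succ_ne_zero _⟩
    · intro f _ g _ h
      funext i
      exact Fin.succ_injective m (congrFun h i)
    · intro f hf
      simp only [Finset.mem_filter, Finset.mem_univ, true_and] at hf
      refine ⟨fun i => (f i).pred (hf.2 i), ?_, by simp⟩
      simp only [Finset.mem_filter, Finset.mem_univ, true_and]
      intro i j h
      exact hf.1 (Fin.pred_inj.1 h)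
    · intros; rfl
  · simp only [Finset.mul_sum]
    rw [Finset.sum_sigma']
    symm
    refine Finset.sum_bij (fun f _ => f.1.insertNth (α := fun _ => Fin (m + 1)) 0
      (fun k => (f.2 k).succ)) ?_ ?_ ?_ ?_
    · rintro ⟨i, f⟩ hf
      simp only [Finset.mem_sigma, Finset.mem_filter, Finset.mem_univ, true_and] at hf ⊢
      refine ⟨?_, fun h => h i (by simp)⟩
      intro a b
      rcases Fin.eq_self_or_eq_succAbove i a with ha | ⟨a, rfl⟩ <;>
        rcases Fin.eq_self_or_eq_succAbove i b with hb | ⟨b, rfl⟩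
      · simp [ha, hb]
      · simp [ha, (Fin.succ_ne_zero _).symm]
      · simp [hb]
      · simpa using fun h => hf h
    · rintro ⟨i, f⟩ hf ⟨j, g⟩ hg h
      simp only at h
      have hij : i = j := by
        by_contra hne
        obtain ⟨k, hk⟩ := Fin.exists_succAbove_eq hne
        have := congrFun h i
        rw [← hk, Fin.insertNth_apply_succAbove, hk, Fin.insertNth_apply_same] at this
        exact Fin.succ_ne_zero _ this.symm
      subst hij
      congr 1
      funext k
      have := congrFun h (i.succAbove k)
      simpa using this
    · intro f hf
      simp only [Finset.mem_filter, Finset.mem_univ, true_and, not_forall, not_not] at hf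
      obtain ⟨hinj, i, hi⟩ := hf
      have hne : ∀ k, f (i.succAbove k) ≠ 0 := fun k h =>
        Fin.succAbove_ne i k (hinj (h.trans hi.symm))
      refine ⟨⟨i, fun k => (f (i.succAbove k)).pred (hne k)⟩, ?_, ?_⟩
      · simp only [Finset.mem_sigma, Finset.mem_filter, Finset.mem_univ, true_and]
        intro a b h
        exact Fin.succAbove_right_injective (hinj (Fin.pred_inj.1 h))
      · funext a
        rcases Fin.eq_self_or_eq_succAbove i a with rfl | ⟨a, rfl⟩ <;> simp [hi]
    · rintro ⟨i, f⟩ _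
      simp [Fin.prod_univ_succAbove _ i]

/-- Adjoining the zero b multiplies every old entry by x_i - b, while the new column has entries ∏
(x_i - y_j), free of b. This makes the dependence on b explicit. -/
theorem clearedPermanent_cons {R : Type*} [CommRing R] {N m : ℕ} (x : Fin (N + 1) → R) (b : R)
    (y : Fin m → R) :
    clearedPermanent x (Fin.cons b y : Fin (m + 1) → R) =
      (∏ i, (x i - b)) * clearedPermanent x y +
        ∑ i, (∏ j, (x i - y j)) *
          ((∏ k, (x (i.succAbove k) - b)) * clearedPermanent (x ∘ i.succAbove) y) := by
  have h0 : ∀ a : R, ∏ l ∈ Finset.univ.erase (0 : Fin (m + 1)),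
      (a - (Fin.cons b y : Fin (m + 1) → R) l) = ∏ j, (a - y j) := by
    intro a
    rw [show Finset.univ.erase (0 : Fin (m + 1)) = Finset.univ.map (Fin.succEmb m) by
      ext l; cases l using Fin.cases <;> simp]
    simp
  have hs : ∀ (a : R) (j : Fin m), ∏ l ∈ Finset.univ.erase j.succ,
      (a - (Fin.cons b y : Fin (m + 1) → R) l) =
        (a - b) * ∏ l ∈ Finset.univ.erase j, (a - y l) := by
    intro a j
    rw [show Finset.univ.erase j.succ =
        Finset.cons 0 ((Finset.univ.erase j).map (Fin.succEmb m)) (by simp) by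
      ext l; cases l using Fin.cases <;> simp [eq_comm]]
    rw [Finset.prod_cons, Finset.prod_map]
    simp
  unfold clearedPermanent
  rw [rectPermanent_succ]
  congr 1
  · rw [← rectPermanent_mul_row]
    congr 1
    ext i j
    simp [hs]
  · refine Finset.sum_congr rfl fun i _ => ?_
    rw [← rectPermanent_mul_row]
    congr 1
    · simp [h0]
    · congr 1
      ext k j
      simp [hs]

/-! ### Wronskian determinants evaluated at distinct points -/

open Polynomial in
theorem wronskian_X_sub_C_mul_right {R : Type*} [CommRing R] (f Q : R[X]) (b : R) :
    wronskian f ((X - C b) * Q) = (X - C b) * wronskian f Q + f * Q := by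
  simp only [wronskian, derivative_mul, derivative_X_sub_C]
  ring

open Polynomial in
theorem wronskian_mul_mul {R : Type*} [CommRing R] (g f Q : R[X]) :
    wronskian (g * f) (g * Q) = g ^ 2 * wronskian f Q := by
  simp only [wronskian, derivative_mul]
  ring

theorem Matrix.det_eq_mul_of_row_eq_single_zero {R : Type*} [CommRing R] {N : ℕ}
    (B : Matrix (Fin (N + 1)) (Fin (N + 1)) R) (i : Fin (N + 1)) (h : ∀ j : Fin N, B i j.succ = 0) :
    B.det = (-1) ^ (i : ℕ) * B i 0 * (B.submatrix i.succAbove Fin.succ).det := by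
  rw [Matrix.det_succ_row B i, Fin.sum_univ_succ]
  simp [h]

/-- Subtracting x_i times the preceding column from each column turns row i into (1, 0, …, 0). -/
theorem det_vandermonde_succAbove {R : Type*} [CommRing R] {N : ℕ} (x : Fin (N + 1) → R)
    (i : Fin (N + 1)) :
    (Matrix.vandermonde x).det = (-1) ^ (i : ℕ) * ((∏ k, (x (i.succAbove k) - x i)) *
      (Matrix.vandermonde (x ∘ i.succAbove)).det) := by
  let B : Matrix (Fin (N + 1)) (Fin (N + 1)) R :=
    Matrix.of fun k => Fin.cons 1 fun j : Fin N => (x k - x i) * x k ^ (j : ℕ)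
  rw [Matrix.det_eq_of_forall_col_eq_smul_add_pred (B := B) (fun _ => x i) (by simp [B])
    (by intro k j; simp [B, Matrix.vandermonde_apply]; ring),
    Matrix.det_eq_mul_of_row_eq_single_zero B i (by simp [B]), mul_assoc]
  congr 1
  rw [← Matrix.det_mul_column]
  simp only [B, Matrix.of_apply, Fin.cons_zero, one_mul]
  congr 1

-- The same column operation replaces X^(j+1) by (X - x_i) X^j, whose Wronskian with (X - x_i) Q is
-- (X - x_i)^2 W(X^j, Q). This vanishes at x_i, so only Q(x_i) remains in row i.
open Polynomial in
theorem det_wronskianEvalMatrix_X_sub_C_mul {R : Type*} [CommRing R] {N : ℕ}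
    (x : Fin (N + 1) → R) (Q : R[X]) (i : Fin (N + 1)) :
    (wronskianEvalMatrix x ((X - C (x i)) * Q)).det =
      (-1) ^ (i : ℕ) * Q.eval (x i) * ((∏ k, (x (i.succAbove k) - x i)) ^ 2 *
        (wronskianEvalMatrix (x ∘ i.succAbove) Q).det) := by
  let B : Matrix (Fin (N + 1)) (Fin (N + 1)) R :=
    Matrix.of fun k => Fin.cons ((wronskian 1 ((X - C (x i)) * Q)).eval (x k)) fun j : Fin N =>
      (x k - x i) ^ 2 * (wronskian (X ^ (j : ℕ)) Q).eval (x k)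
  rw [Matrix.det_eq_of_forall_col_eq_smul_add_pred (B := B) (fun _ => x i)
    (by simp [B, wronskianEvalMatrix]) ?_,
    Matrix.det_eq_mul_of_row_eq_single_zero B i (by simp [B])]
  · congr 1
    · simp [B, wronskian_X_sub_C_mul_right]
    · rw [← Finset.prod_pow, ← Matrix.det_mul_column]
      congr 1
  · intro k j
    have : (X ^ ((j : ℕ) + 1) : R[X]) = (X - C (x i)) * X ^ (j : ℕ) + C (x i) * X ^ (j : ℕ) := by
      ring
    have h2 : wronskian (C (x i) * X ^ (j : ℕ)) ((X - C (x i)) * Q) =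
        C (x i) * wronskian (X ^ (j : ℕ)) ((X - C (x i)) * Q) := by
      simp only [wronskian, derivative_mul, derivative_C]
      ring
    simp only [wronskianEvalMatrix, B, Matrix.of_apply, Fin.cons_succ, Fin.val_succ,
      Fin.val_castSucc]
    rw [this, wronskian_add_left, wronskian_mul_mul, h2]
    simp

-- Induction on the number of zeros of Q. As functions of a new zero b, both sides are polynomials
-- of degree at most the number of points x_i; they have the same top coefficient and agree at every
-- b = x_i.
open Polynomial in
theorem det_wronskianEvalMatrix_of_injective {R : Type*} [CommRing R] [IsDomain R] {N m : ℕ}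
    (x : Fin N → R) (hx : Function.Injective x) (y : Fin m → R) :
    (wronskianEvalMatrix x (∏ j, (X - C (y j)))).det =
      (Matrix.vandermonde x).det * clearedPermanent x y := by
  induction m generalizing N with
  | zero =>
    cases N with
    | zero => simp [clearedPermanent, rectPermanent]
    | succ N =>
      rw [Matrix.det_eq_zero_of_column_eq_zero 0 (by simp [wronskianEvalMatrix, wronskian])]
      have : IsEmpty (Fin (N + 1) ↪ Fin 0) := ⟨fun f => (f 0).elim0⟩
      simp [clearedPermanent, rectPermanent]
  | succ m ih =>
    cases N with
    | zero =>
      have : Unique (Fin 0 ↪ Fin (m + 1)) := ⟨⟨⟨Fin.elim0, fun a => a.elim0⟩⟩, fun f => by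
        ext a; exact a.elim0⟩
      simp [clearedPermanent, rectPermanent]
    | succ N =>
      obtain ⟨b, y, rfl⟩ : ∃ b y', y = (Fin.cons b y' : Fin (m + 1) → R) :=
        ⟨y 0, Fin.tail y, (Fin.cons_self_tail y).symm⟩
      rw [clearedPermanent_cons]
      set Q : R[X] := ∏ j, (X - C (y j)) with hQ
      have hprod : ∏ j, (X - C ((Fin.cons b y : Fin (m + 1) → R) j)) = (X - C b) * Q := by
        simp [Fin.prod_univ_succ, hQ]
      have hQe : ∀ a, Q.eval a = ∏ j, (a - y j) := fun a => by simp [hQ, eval_prod]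
      rw [hprod]
      -- By W(f, (X - b) Q) = (X - b) W(f, Q) + f Q, the matrix for (X - b) Q is `B - b W`, affine
      -- in b.
      let W := wronskianEvalMatrix x Q
      let B : Matrix (Fin (N + 1)) (Fin (N + 1)) R :=
        Matrix.of fun i k => x i * W i k + Q.eval (x i) * x i ^ (k : ℕ)
      let F : R[X] := ((X : R[X]) • (-W).map C + B.map C).det
      let G : R[X] := C ((Matrix.vandermonde x).det * clearedPermanent x y) * ∏ i, (C (x i) - X) +
        ∑ i, C ((Matrix.vandermonde x).det * Q.eval (x i) *
          clearedPermanent (x ∘ i.succAbove) y) * ∏ k, (C (x (i.succAbove k)) - X)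
      have hF : ∀ b, F.eval b = (wronskianEvalMatrix x ((X - C b) * Q)).det := by
        intro b
        rw [← coe_evalRingHom, RingHom.map_det]
        congr 1
        ext i k
        simp [W, B, wronskianEvalMatrix, wronskian_X_sub_C_mul_right]
        ring
      have hG : ∀ b, G.eval b = (Matrix.vandermonde x).det *
          ((∏ i, (x i - b)) * clearedPermanent x y +
            ∑ i, (∏ j, (x i - y j)) *
              ((∏ k, (x (i.succAbove k) - b)) * clearedPermanent (x ∘ i.succAbove) y)) := by
        intro b
        simp only [G, eval_add, eval_mul, eval_C, eval_prod, eval_sub, eval_X, eval_finsetSum, hQe,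
          mul_add, Finset.mul_sum]
        congr 1
        · ring
        · exact Finset.sum_congr rfl fun i _ => by ring
      have hneg : ∀ (n : ℕ) (z : Fin n → R), ∏ i, (C (z i) - X) =
          C ((-1) ^ n) * ∏ i, (X - C (z i)) := by
        intro n z
        rw [Finset.prod_congr rfl fun i _ => (neg_sub X (C (z i))).symm, Finset.prod_neg]
        simp
      have hdeg : ∀ (n : ℕ) (z : Fin n → R), (∏ i, (C (z i) - X)).natDegree ≤ n := by
        intro n z
        rw [hneg]
        refine (natDegree_C_mul_le _ _).trans ?_
        simp
      have hcoeff : ∀ (n : ℕ) (z : Fin n → R), (∏ i, (C (z i) - X)).coeff n = (-1) ^ n := by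
        intro n z
        have hm : (∏ i, (X - C (z i))).coeff n = 1 := by
          have := (monic_prod_X_sub_C z Finset.univ).coeff_natDegree
          simpa using this
        rw [hneg, coeff_C_mul, hm, mul_one]
      have hFG : F = G := by
        refine eq_of_degree_sub_lt_of_eval_index_eq (v := x) Finset.univ hx.injOn ?_ ?_
        · rw [degree_lt_iff_coeff_zero]
          intro k hk
          have hk : N + 1 ≤ k := by simpa using hk
          have hsum : (∑ i, C ((Matrix.vandermonde x).det * Q.eval (x i) *
              clearedPermanent (x ∘ i.succAbove) y) *
                ∏ k, (C (x (i.succAbove k)) - X)).coeff k = 0 := by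
            rw [finsetSum_coeff]
            refine Finset.sum_eq_zero fun i _ => ?_
            rw [coeff_C_mul, coeff_eq_zero_of_natDegree_lt
              ((hdeg N fun k => x (i.succAbove k)).trans_lt hk), mul_zero]
          rw [coeff_sub, coeff_add, hsum, coeff_C_mul]
          rcases hk.eq_or_lt with rfl | hk
          -- The coefficient of b^(N+1) in `F` is det(-W), known by induction for the same points
          -- and one zero fewer.
          · have := coeff_det_X_add_C_card (-W) B
            rw [Fintype.card_fin] at this
            rw [this, hcoeff, Matrix.det_neg, ih x hx]
            simp
            ring
          · have := natDegree_det_X_add_C_le (-W) B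
            rw [Fintype.card_fin] at this
            rw [coeff_eq_zero_of_natDegree_lt (this.trans_lt hk),
              coeff_eq_zero_of_natDegree_lt ((hdeg _ x).trans_lt hk)]
            simp
        · intro i _
          -- At b = x_i only the i-th summand of `G` survives. On the left, x_i drops out of the
          -- points, and induction applies to the others.
          rw [hF, hG, det_wronskianEvalMatrix_X_sub_C_mul,
            ih (x ∘ i.succAbove) (hx.comp Fin.succAbove_right_injective),
            Finset.prod_eq_zero (Finset.mem_univ i) (sub_self _), zero_mul, zero_add,
            Finset.sum_eq_single i _ (by simp), det_vandermonde_succAbove x i, hQe]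
          · ring
          · intro j _ hj
            obtain ⟨k, hk⟩ := Fin.exists_succAbove_eq hj.symm
            rw [Finset.prod_eq_zero (Finset.mem_univ k) (by rw [hk, sub_self])]
            ring
      rw [← hF, hFG, hG]

/-! ### Reduction modulo P, and removal of distinctness -/

open Polynomial in
/-- The matrix, in the basis `1, X, …, X ^ (N - 1)`, of the map sending a polynomial of degree less
than `N` to its Wronskian with `Q`, reduced modulo the monic polynomial `P` of degree `N`. -/
noncomputable def wronskianModMatrix {R : Type*} [CommRing R] (N : ℕ) (P Q : R[X]) :
    Matrix (Fin N) (Fin N) R :=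
  Matrix.of fun i k => (wronskian (X ^ (k : ℕ)) Q %ₘ P).coeff i

open Polynomial in
theorem vandermonde_mul_wronskianModMatrix {R : Type*} [CommRing R] {N : ℕ} (x : Fin N → R)
    (Q : R[X]) :
    Matrix.vandermonde x * wronskianModMatrix N (∏ i, (X - C (x i))) Q =
      wronskianEvalMatrix x Q := by
  nontriviality R
  have hm := monic_prod_X_sub_C x Finset.univ
  ext i k
  set f := wronskian (X ^ (k : ℕ)) Q with hf
  have hdeg : (f %ₘ ∏ i, (X - C (x i))).degree < (N : ℕ) := by
    refine (degree_modByMonic_lt f hm).trans_le ?_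
    rw [degree_eq_natDegree hm.ne_zero]
    simp
  have hroot : (∏ i, (X - C (x i))).eval (x i) = 0 := by
    rw [eval_prod]
    exact Finset.prod_eq_zero (Finset.mem_univ i) (by simp)
  have heval : (f %ₘ ∏ i, (X - C (x i))).eval (x i) = f.eval (x i) := by
    conv_rhs => rw [← modByMonic_add_div f (∏ i, (X - C (x i)))]
    simp [hroot]
  rw [Matrix.mul_apply, wronskianEvalMatrix, Matrix.of_apply, ← hf, ← heval]
  rcases eq_or_ne (f %ₘ ∏ i, (X - C (x i))) 0 with h0 | h0
  · simp [wronskianModMatrix, ← hf, h0]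
  · rw [eval_eq_sum_range' ((natDegree_lt_iff_degree_lt h0).2 hdeg), ← Fin.sum_univ_eq_sum_range
      (fun l => (f %ₘ ∏ i, (X - C (x i))).coeff l * x i ^ l)]
    refine Finset.sum_congr rfl fun l _ => ?_
    simp only [wronskianModMatrix, Matrix.of_apply, Matrix.vandermonde_apply, ← hf]
    ring

open Polynomial in
theorem wronskianModMatrix_map {R S : Type*} [CommRing R] [CommRing S] (φ : R →+* S) (N : ℕ)
    {P : R[X]} (hP : P.Monic) (Q : R[X]) :
    φ.mapMatrix (wronskianModMatrix N P Q) = wronskianModMatrix N (P.map φ) (Q.map φ) := by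
  ext i k
  simp only [wronskianModMatrix, RingHom.mapMatrix_apply, Matrix.map_apply, Matrix.of_apply]
  rw [← coeff_map, map_modByMonic φ hP]
  simp [wronskian, ← derivative_map]

theorem clearedPermanent_map {R S : Type*} [CommRing R] [CommRing S] (φ : R →+* S) {N m : ℕ}
    (x : Fin N → R) (y : Fin m → R) :
    φ (clearedPermanent x y) = clearedPermanent (φ ∘ x) (φ ∘ y) := by
  simp [clearedPermanent, rectPermanent]

open Polynomial in
theorem det_wronskianModMatrix {R : Type*} [CommRing R] {N m : ℕ} (x : Fin N → R)
    (y : Fin m → R) :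
    (wronskianModMatrix N (∏ i, (X - C (x i))) (∏ j, (X - C (y j)))).det =
      clearedPermanent x y := by
  let u : Fin N → MvPolynomial (Fin N ⊕ Fin m) ℤ := fun i => MvPolynomial.X (Sum.inl i)
  let v : Fin m → MvPolynomial (Fin N ⊕ Fin m) ℤ := fun j => MvPolynomial.X (Sum.inr j)
  let φ : MvPolynomial (Fin N ⊕ Fin m) ℤ →+* R :=
    MvPolynomial.eval₂Hom (Int.castRingHom R) (Sum.elim x y)
  have hu : Function.Injective u := fun i j h =>
    Sum.inl_injective (MvPolynomial.X_injective h)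
  have key : (wronskianModMatrix N (∏ i, (X - C (u i))) (∏ j, (X - C (v j)))).det =
      clearedPermanent u v := by
    -- Over ℤ[x, y] the points are distinct variables, so the Vandermonde determinant is nonzero in
    -- a domain.
    apply mul_left_cancel₀ (Matrix.det_vandermonde_ne_zero_iff.2 hu)
    rw [← Matrix.det_mul, vandermonde_mul_wronskianModMatrix,
      det_wronskianEvalMatrix_of_injective u hu v]
  have h := congrArg φ key
  rw [RingHom.map_det, wronskianModMatrix_map φ N (monic_prod_X_sub_C u Finset.univ),
    clearedPermanent_map] at h
  have hux : φ ∘ u = x := by funext i; simp [φ, u]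
  have hvy : φ ∘ v = y := by funext i; simp [φ, v]
  have hux' : ∀ i, φ (u i) = x i := fun i => congrFun hux i
  have hvy' : ∀ i, φ (v i) = y i := fun i => congrFun hvy i
  simpa [Polynomial.map_prod, hux, hvy, hux', hvy'] using h

open Polynomial in
theorem wronskianModMatrix_C_mul {R : Type*} [CommRing R] (N : ℕ) (P Q : R[X]) (c : R) :
    wronskianModMatrix N P (C c * Q) = c • wronskianModMatrix N P Q := by
  ext i k
  have : wronskian (X ^ (k : ℕ)) (C c * Q) = c • wronskian (X ^ (k : ℕ)) Q := by
    rw [← smul_eq_C_mul, ← wronskianBilin_apply, map_smul, wronskianBilin_apply]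
  simp [wronskianModMatrix, this, smul_modByMonic]

/-! ### The jumping-diagonal determinant through functionals modulo P -/

theorem residueFromOne_add_eq_iff {n : ℕ} (r : ℤ) (i k : ℕ) (hi : i < n - 1) (hk : k < n - 1) :
    (i + 1 = residueFromOne r n + k ∨ i + 1 + n = residueFromOne r n + k) ↔
      ((i : ℤ) + 1 : ℤ) ≡ r + k [ZMOD n] := by
  have hn : (0 : ℤ) < n := by omega
  have h0 := Int.emod_nonneg (r - 1) hn.ne'
  have h1 := Int.emod_lt_of_pos (r - 1) hn
  have h2 := Int.emod_add_mul_ediv (r - 1) n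
  rw [Int.modEq_iff_dvd]
  unfold residueFromOne
  generalize (r - 1) % (n : ℤ) = s at *
  generalize (r - 1) / (n : ℤ) = q at *
  obtain ⟨s, rfl⟩ := Int.eq_ofNat_of_zero_le h0
  simp only [Int.toNat_natCast]
  constructor
  · rintro (h | h)
    · exact ⟨q, by omega⟩
    · exact ⟨q + 1, by rw [mul_add]; omega⟩
  · rintro ⟨d, hd⟩
    have hd' : (n : ℤ) * (d - q) = s + 1 + k - (i + 1) := by rw [mul_sub]; omega
    -- The right side of `hd'` lies strictly between -n and 2n, so it can only be the multiple 0 or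
    -- n: the two alternatives in the definition of `jumpDiag`.
    have hlt : d - q < 2 := by
      by_contra hc
      have := mul_le_mul_of_nonneg_left (not_lt.1 hc) hn.le
      omega
    have hgt : -1 < d - q := by
      by_contra hc
      have := mul_le_mul_of_nonneg_left (not_lt.1 hc) hn.le
      omega
    obtain h | h : d - q = 0 ∨ d - q = 1 := by omega
    · rw [h] at hd'; omega
    · rw [h] at hd'; omega

open Polynomial in
/-- The functional `X ^ e ↦ [e ≡ i] - [e ≡ i + 1]` (congruences modulo `n`), which kills the ideal
generated by `1 + X + ⋯ + X ^ (n - 1)`. -/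
noncomputable def cyclicDiff (R : Type*) [CommRing R] (n : ℕ) (i : ℤ) : R[X] →ₗ[R] R :=
  open Classical in
  lsum fun e => LinearMap.toSpanSingleton R R
    ((if (i + 1 : ℤ) ≡ e + 1 [ZMOD n] then 1 else 0) - (if (i + 1 : ℤ) ≡ e [ZMOD n] then 1 else 0))

open Polynomial Classical in
theorem cyclicDiff_C_mul_X_pow {R : Type*} [CommRing R] (n : ℕ) (i : ℤ) (c : R) (e : ℕ) :
    cyclicDiff R n i (C c * X ^ e) = c *
      ((if (i + 1 : ℤ) ≡ e + 1 [ZMOD n] then 1 else 0) -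
        (if (i + 1 : ℤ) ≡ e [ZMOD n] then 1 else 0)) := by
  rw [C_mul_X_pow_eq_monomial, cyclicDiff, lsum_apply, sum_monomial_index] <;> simp

-- On X^k (1 + X + ⋯ + X^(n-1)) the differences of indicators telescope over a full period.
open Polynomial in
theorem cyclicDiff_mul_geom_sum {R : Type*} [CommRing R] (n : ℕ) (i : ℤ) (f : R[X]) :
    cyclicDiff R n i (f * ∑ j ∈ Finset.range n, X ^ j) = 0 := by
  classical
  induction f using Polynomial.induction_on' with
  | add p q hp hq => rw [add_mul, map_add, hp, hq, add_zero]
  | monomial k c =>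
    rw [← C_mul_X_pow_eq_monomial, Finset.mul_sum, map_sum]
    simp_rw [mul_assoc, ← pow_add, cyclicDiff_C_mul_X_pow]
    rw [← Finset.mul_sum]
    have := Finset.sum_range_sub
      (fun j : ℕ => if (i + 1 : ℤ) ≡ ((k + j : ℕ) : ℤ) [ZMOD n] then (1 : R) else 0) n
    have hper : ((i + 1 : ℤ) ≡ ((k + n : ℕ) : ℤ) [ZMOD n]) ↔
        ((i + 1 : ℤ) ≡ ((k + 0 : ℕ) : ℤ) [ZMOD n]) := by
      simp [Int.ModEq]
    rw [if_congr hper rfl rfl, sub_self] at this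
    convert mul_zero c using 2
    simpa [add_assoc] using this

open Polynomial in
theorem wronskian_X_pow_C_mul_X_pow {R : Type*} [CommRing R] (k r : ℕ) (c : R) :
    wronskian (X ^ k) (C c * X ^ r) = C (((r : R) - k) * c) * X ^ (r + k - 1) := by
  rcases k with _ | k <;> rcases r with _ | r
  · simp [wronskian]
  · simp [wronskian]
    ring
  · simp [wronskian]
    ring
  · rw [show r + 1 + (k + 1) - 1 = r + k + 1 by omega]
    simp [wronskian]
    ring

open Polynomial in
theorem coeff_sum_C_mul_X_pow {R : Type*} [CommRing R] (d : ℕ) (b : ℕ → R) (e : ℕ) :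
    (∑ r ∈ Finset.range d, C (b r) * X ^ r).coeff e = if e < d then b e else 0 := by
  simp [finsetSum_coeff, coeff_X_pow]

open Polynomial in
theorem natDegree_sum_C_mul_X_pow {R : Type*} [CommRing R] (d : ℕ) (b : ℕ → R) (hb : b d ≠ 0) :
    (∑ r ∈ Finset.range (d + 1), C (b r) * X ^ r).natDegree = d :=
  natDegree_eq_of_le_of_coeff_ne_zero
    (natDegree_le_iff_coeff_eq_zero.2 fun e he => by
      rw [coeff_sum_C_mul_X_pow, if_neg (by omega)])
    (by rwa [coeff_sum_C_mul_X_pow, if_pos (by omega)])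

open Polynomial in
theorem leadingCoeff_sum_C_mul_X_pow {R : Type*} [CommRing R] (d : ℕ) (b : ℕ → R) (hb : b d ≠ 0) :
    (∑ r ∈ Finset.range (d + 1), C (b r) * X ^ r).leadingCoeff = b d := by
  rw [leadingCoeff, natDegree_sum_C_mul_X_pow d b hb, coeff_sum_C_mul_X_pow, if_pos (by omega)]

open Polynomial in
theorem fesTilde_eq_det_cyclicDiff {R : Type*} [CommRing R] (n m : ℕ) (a : ℕ → R) :
    fesTilde n m a = (Matrix.of fun i k : Fin (n - 1) => cyclicDiff R n (i : ℕ)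
      (wronskian (X ^ (k : ℕ)) (∑ r ∈ Finset.range (m + 1), C (a r) * X ^ r))).det := by
  classical
  unfold fesTilde
  congr 1
  ext i k
  rw [Matrix.sub_apply, Matrix.sum_apply, Matrix.sum_apply, ← Finset.sum_sub_distrib,
    Matrix.of_apply, ← wronskianBilin_apply, map_sum, map_sum]
  refine Finset.sum_congr rfl fun r _ => ?_
  rw [wronskianBilin_apply, wronskian_X_pow_C_mul_X_pow, cyclicDiff_C_mul_X_pow]
  simp only [jumpDiag, Matrix.of_apply, residueFromOne_add_eq_iff _ _ _ i.2 k.2]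
  -- For r = k = 0 the exponent r + k - 1 is truncated to 0, harmlessly: the coefficient r - k
  -- vanishes.
  rcases Nat.eq_zero_or_pos (r + k) with h | h
  · obtain ⟨hr, hk⟩ : r = 0 ∧ (k : ℕ) = 0 := by omega
    simp [hr, hk]
  · rw [show ((r + (k : ℕ) - 1 : ℕ) : ℤ) = (r : ℤ) - 1 + (k : ℕ) by omega,
      show (r : ℤ) - 1 + (k : ℕ) + 1 = r + (k : ℕ) by ring, mul_sub, mul_ite, mul_ite]
    simp

-- For l ≤ i one has 0 < i + 1 - l < n, so the subtracted indicator vanishes and the other one is 1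
-- only at l = i: the matrix is upper unitriangular.
open Polynomial in
theorem det_cyclicDiff_X_pow {R : Type*} [CommRing R] (n : ℕ) :
    (Matrix.of fun i l : Fin (n - 1) => cyclicDiff R n (i : ℕ) (X ^ (l : ℕ))).det = 1 := by
  classical
  have hval : ∀ i l : Fin (n - 1), l ≤ i →
      cyclicDiff R n (i : ℕ) (X ^ (l : ℕ)) = if l = i then 1 else 0 := by
    intro i l hli
    have hli : (l : ℕ) ≤ i := hli
    have hi := i.2
    have h := cyclicDiff_C_mul_X_pow n (i : ℕ) (1 : R) l
    rw [C_1, one_mul, one_mul] at h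
    have h1 : ¬((i : ℕ) + 1 : ℤ) ≡ (l : ℕ) [ZMOD n] := by
      intro hc
      have := Int.le_of_dvd (by omega) hc.symm.dvd
      omega
    have h2 : ((i : ℕ) + 1 : ℤ) ≡ (l : ℕ) + 1 [ZMOD n] ↔ l = i := by
      refine ⟨fun hc => ?_, fun hc => by rw [hc]⟩
      by_contra hne
      have hne : (l : ℕ) ≠ i := fun h => hne (Fin.ext h)
      have := Int.le_of_dvd (by omega) hc.symm.dvd
      omega
    rw [h, if_neg h1, sub_zero, if_congr h2 rfl rfl]
  rw [Matrix.det_of_isUpperTriangular]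
  · exact Finset.prod_eq_one fun i _ => by simp [hval i i le_rfl]
  · intro i l hli
    have hli : l < i := hli
    simp [hval i l hli.le, hli.ne]

open Polynomial in
theorem fesTilde_eq_det_wronskianModMatrix {R : Type*} [CommRing R] {n : ℕ} (hn : 1 ≤ n) (m : ℕ)
    (a : ℕ → R) :
    fesTilde n m a = (wronskianModMatrix (n - 1) (∑ j ∈ Finset.range n, X ^ j)
      (∑ r ∈ Finset.range (m + 1), C (a r) * X ^ r)).det := by
  nontriviality R
  rw [fesTilde_eq_det_cyclicDiff, ← one_mul (Matrix.det (wronskianModMatrix _ _ _)),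
    ← det_cyclicDiff_X_pow n, ← Matrix.det_mul]
  congr 1
  set P : R[X] := ∑ j ∈ Finset.range n, X ^ j with hP
  have hm : P.Monic := monic_geom_sum_X (by omega)
  ext i k
  rw [Matrix.of_apply, Matrix.mul_apply]
  set f := wronskian (X ^ (k : ℕ)) (∑ r ∈ Finset.range (m + 1), C (a r) * X ^ r) with hf
  have hdeg : (f %ₘ P).natDegree < n - 1 := by
    have hPd : P.natDegree = n - 1 := by
      have := natDegree_sum_C_mul_X_pow (R := R) (n - 1) (fun _ => 1) one_ne_zero
      simpa only [C_1, one_mul, Nat.sub_add_cancel hn, ← hP] using this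
    -- A column index exists only if n ≥ 2, which excludes P = 1, where the strict bound on
    -- `natDegree` would fail.
    have hk := k.2
    have hP1 : P ≠ 1 := fun h => by
      rw [h, natDegree_one] at hPd
      omega
    exact hPd ▸ natDegree_modByMonic_lt f hm hP1
  have hred : cyclicDiff R n (i : ℕ) f = cyclicDiff R n (i : ℕ) (f %ₘ P) := by
    conv_lhs => rw [← modByMonic_add_div f P]
    rw [map_add, mul_comm, cyclicDiff_mul_geom_sum, add_zero]
  rw [hred]
  conv_lhs => rw [as_sum_range_C_mul_X_pow' _ hdeg]
  rw [map_sum, ← Fin.sum_univ_eq_sum_range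
    (fun l => cyclicDiff R n (i : ℕ) (C ((f %ₘ P).coeff l) * X ^ l))]
  refine Finset.sum_congr rfl fun l _ => ?_
  rw [← smul_eq_C_mul, map_smul, smul_eq_mul, mul_comm]
  rfl

/-! ### Clearing denominators and conclusion -/

theorem scottPermanent_mul_prod {K : Type*} [Field K] {N m : ℕ} (x : Fin N → K) (y : Fin m → K)
    (hxy : ∀ i j, x i ≠ y j) :
    (∏ i, ∏ j, (x i - y j)) * scottPermanent x y = clearedPermanent x y := by
  unfold scottPermanent clearedPermanent
  rw [← rectPermanent_mul_row]
  congr 1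
  ext i j
  have := sub_ne_zero.2 (hxy i j)
  rw [Matrix.of_apply, Matrix.of_apply, Matrix.of_apply,
    ← Finset.mul_prod_erase _ _ (Finset.mem_univ j)]
  field_simp

theorem theorem4 {K : Type*} [Field K] (n m : ℕ) (hn : 1 ≤ n)
    (P Q : Polynomial K) (a : ℕ → K)
    (hP : P = ∑ i ∈ Finset.range n, Polynomial.X ^ i)
    (hQ : Q = ∑ r ∈ Finset.range (m + 1), Polynomial.C (a r) * Polynomial.X ^ r)
    (ham : a m ≠ 0)
    (x : Fin (n - 1) → K) (hx : P.roots = Multiset.map x Finset.univ.val)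
    (y : Fin m → K) (hy : Q.roots = Multiset.map y Finset.univ.val)
    (hxy : ∀ i j, x i ≠ y j) :
    Polynomial.resultant P Q ≠ 0 ∧
      scottPermanent x y = fesTilde n m a / Polynomial.resultant P Q := by
  have hQd := natDegree_sum_C_mul_X_pow m a ham
  have hQl := leadingCoeff_sum_C_mul_X_pow m a ham
  have hPd := natDegree_sum_C_mul_X_pow (R := K) (n - 1) (fun _ => 1) one_ne_zero
  have hPl := leadingCoeff_sum_C_mul_X_pow (R := K) (n - 1) (fun _ => 1) one_ne_zero
  simp only [Polynomial.C_1, one_mul, Nat.sub_add_cancel hn] at hPd hPl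
  rw [← hP] at hPd hPl
  rw [← hQ] at hQd hQl
  have hPcard : Multiset.card P.roots = P.natDegree := by simp [hx, hPd]
  have hPx : P = ∏ i, (Polynomial.X - Polynomial.C (x i)) := by
    rw [← Polynomial.prod_multiset_X_sub_C_of_monic_of_roots_card_eq hPl hPcard, hx,
      Multiset.map_map]
    rfl
  have hQy : Q = Polynomial.C (a m) * ∏ j, (Polynomial.X - Polynomial.C (y j)) := by
    conv_lhs => rw [← Polynomial.C_leadingCoeff_mul_prod_multiset_X_sub_C (p := Q)
      (by simp [hy, hQd]), hQl, hy, Multiset.map_map]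
    rfl
  have hres : Polynomial.resultant P Q = a m ^ (n - 1) * ∏ i, ∏ j, (x i - y j) := by
    rw [Polynomial.resultant_eq_prod_eval P Q _ le_rfl
      (Polynomial.splits_iff_card_roots.2 hPcard), hPl, one_pow, one_mul, hx, Multiset.map_map]
    change ∏ i, Q.eval (x i) = _
    rw [hQy]
    simp [Polynomial.eval_prod, Finset.prod_mul_distrib]
  have hprod : ∏ i, ∏ j, (x i - y j) ≠ 0 :=
    Finset.prod_ne_zero_iff.2 fun i _ => Finset.prod_ne_zero_iff.2 fun j _ =>
      sub_ne_zero.2 (hxy i j)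
  have hres0 : Polynomial.resultant P Q ≠ 0 := hres ▸ mul_ne_zero (pow_ne_zero _ ham) hprod
  refine ⟨hres0, ?_⟩
  -- Extracting the leading coefficient a_m from a matrix of size n - 1 gives a_m^(n-1), the factor
  -- present in the resultant.
  rw [eq_div_iff hres0, fesTilde_eq_det_wronskianModMatrix hn, ← hP, ← hQ, hPx, hQy,
    wronskianModMatrix_C_mul, Matrix.det_smul, det_wronskianModMatrix, ← hPx, ← hQy, hres,
    ← scottPermanent_mul_prod x y hxy, Fintype.card_fin]
  ring
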